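/- Let $\mathbb{D}$ be the open unit disk, $\mathbb{T}$ the unit circle with normalized Lebesgue measure $m$, and $\mathbb{D}_e=\{|z|>1\}\cup\{\infty\}$. Let $H^2$ be the Hardy space of analytic functions $f$ on $\mathbb{D}$ with $\lim_{r\to1^-}\int_{\mathbb{T}}|f(r\zeta)|^2\,dm(\zeta)<\infty$, with inner product $\langle f,g\rangle=\int_{\mathbb{T}}f\,\overline{g}\,dm$ of the radial boundary functions, and let $H^2(\mathbb{D}_e)=\{g(1/z): g\in H^2\}$. Let $u$ be an inner function, that is, a bounded analytic function on $\mathbb{D}$ whose radial limits have modulus $1$ almost everywhere on $\mathbb{T}$, and let $\mathcal{K}_u=H^2\ominus uH^2=\{f\in H^2:\langle f,uh\rangle=0\text{ for all }h\in H^2\}$. Meromorphic functions $g$ on $\mathbb{D}$ and $G$ on $\mathbb{D}_e$ are called pseudocontinuations of one another if, for almost every $\zeta\in\mathbb{T}$, the nontangential limit of $g$ at $\zeta$ (from $\mathbb{D}$) and the nontangential limit of $G$ at $\zeta$ (from $\mathbb{D}_e$) exist and agree. Here nontangential limits are limits within every Stolz region $\{z\in\mathbb{D}:|z-\zeta|<\alpha(1-|z|)\}$,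 respectively $\{|z|>1:|z-\zeta|<\alpha(|z|-1)\}$, $\alpha>1$. **Theorem (Douglas–Shapiro–Shields).** A function $f\in H^2$ belongs to $\mathcal{K}_u$ if and only if $f/u$ has a pseudocontinuation $F_u\in H^2(\mathbb{D}_e)$ with $F_u(\infty)=0$. -/

import Mathlib

open Filter Topology MeasureTheory Metric
open scoped ComplexConjugate Real

noncomputable section

namespace ModelSpace

/-- Normalized Lebesgue measure `m` on the unit circle `𝕋`, as a probability measure on `ℂ`
carried by `𝕋`. -/
def circleMeasure : Measure ℂ :=
  haveI : Fact (0 < 2 * π) := ⟨Real.two_pi_pos⟩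
  Measure.map (fun t : AddCircle (2 * π) => (AddCircle.toCircle t : ℂ)) AddCircle.haarAddCircle

/-- `f ∈ H²`: `f` is analytic on the unit disk and the limit as `r → 1⁻` of its (increasing)
quadratic integral means is finite. Functions on `𝔻` are represented by functions on `ℂ` whose
values off `𝔻` are irrelevant. -/
def MemH2 (f : ℂ → ℂ) : Prop :=
  DifferentiableOn ℂ f (ball 0 1) ∧
    ∃ L : ℝ, Tendsto (fun r : ℝ => ∫ ζ, ‖f (r * ζ)‖ ^ 2 ∂circleMeasure) (𝓝[<] 1) (𝓝 L)

/-- The radial boundary function `ζ ↦ lim_{r → 1⁻} f (r ζ)`. For functions in `H²` the limit exists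
for almost every `ζ ∈ 𝕋`. -/
def boundaryValue (f : ℂ → ℂ) (ζ : ℂ) : ℂ :=
  limUnder (𝓝[<] (1 : ℝ)) (fun r : ℝ => f (r * ζ))

/-- The inner product `⟨f, g⟩ = ∫_𝕋 f(ζ) conj(g(ζ)) dm(ζ)` of `H²`. -/
def innerH2 (f g : ℂ → ℂ) : ℂ :=
  ∫ ζ, boundaryValue f ζ * conj (boundaryValue g ζ) ∂circleMeasure

/-- `u` is an inner function: bounded and analytic on `𝔻`, with radial limits of modulus one at
almost every point of `𝕋`. -/
def IsInner (u : ℂ → ℂ) : Prop :=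
  DifferentiableOn ℂ u (ball 0 1) ∧
    (∃ C : ℝ, ∀ z ∈ ball (0 : ℂ) 1, ‖u z‖ ≤ C) ∧
    ∀ᵐ ζ ∂circleMeasure, ∃ L : ℂ, ‖L‖ = 1 ∧
      Tendsto (fun r : ℝ => u (r * ζ)) (𝓝[<] 1) (𝓝 L)

/-- The model space `K_u = H² ⊖ u H²`. -/
def modelSpace (u : ℂ → ℂ) : Set (ℂ → ℂ) :=
  {f | MemH2 f ∧ ∀ h : ℂ → ℂ, MemH2 h → innerH2 f (fun z => u z * h z) = 0}

/-- The Stolz region in `𝔻` with vertex `ζ ∈ 𝕋` and aperture `α`. -/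
def stolz (α : ℝ) (ζ : ℂ) : Set ℂ :=
  {z | ‖z‖ < 1 ∧ ‖z - ζ‖ < α * (1 - ‖z‖)}

/-- The Stolz region in the exterior `{|z| > 1}` with vertex `ζ ∈ 𝕋` and aperture `α`. It is the
image of `stolz α ζ ∖ {0}` under the reflection `z ↦ 1 / conj z`. -/
def stolzExt (α : ℝ) (ζ : ℂ) : Set ℂ :=
  {z | 1 < ‖z‖ ∧ ‖z - ζ‖ < α * (‖z‖ - 1)}

/-- `f` has nontangential limit `L` at `ζ` from the unit disk. -/
def HasNTLimit (f : ℂ → ℂ) (ζ L : ℂ) : Prop :=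
  ∀ α : ℝ, 1 < α → Tendsto f (𝓝[stolz α ζ] ζ) (𝓝 L)

/-- A function on the extended exterior disk `𝔻_e = {|z| > 1} ∪ {∞}`, given on the Riemann sphere
`OnePoint ℂ`, has nontangential limit `L` at `ζ` from `𝔻_e`. -/
def HasNTLimitExt (F : OnePoint ℂ → ℂ) (ζ L : ℂ) : Prop :=
  ∀ α : ℝ, 1 < α → Tendsto (fun z : ℂ => F (z : OnePoint ℂ)) (𝓝[stolzExt α ζ] ζ) (𝓝 L)

/-- The coordinate `w ↦ 1 / w` of the Riemann sphere, with `1 / 0 = ∞`. It maps `𝔻` onto `𝔻_e`. -/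
def invSphere (w : ℂ) : OnePoint ℂ :=
  if w = 0 then OnePoint.infty else ((w⁻¹ : ℂ) : OnePoint ℂ)

/-- `F` is meromorphic on `𝔻_e` (including at `∞`), expressed in the coordinate `w = 1 / z`. -/
def MeromorphicOnExt (F : OnePoint ℂ → ℂ) : Prop :=
  MeromorphicOn (fun w : ℂ => F (invSphere w)) (ball 0 1)

/-- `F ∈ H²(𝔻_e) = {g(1/z) : g ∈ H²}`. -/
def MemH2Ext (F : OnePoint ℂ → ℂ) : Prop :=
  ∃ g : ℂ → ℂ, MemH2 g ∧ (∀ z : ℂ, 1 < ‖z‖ → F (z : OnePoint ℂ) = g (1 / z)) ∧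
    F OnePoint.infty = g 0

/-- `f` (meromorphic on `𝔻`) and `F` (meromorphic on `𝔻_e`) are pseudocontinuations of one another:
at almost every point of `𝕋` both have a nontangential limit, and the two limits agree. -/
def IsPseudocontinuation (f : ℂ → ℂ) (F : OnePoint ℂ → ℂ) : Prop :=
  MeromorphicOn f (ball 0 1) ∧ MeromorphicOnExt F ∧
    ∀ᵐ ζ ∂circleMeasure, ∃ L : ℂ, HasNTLimit f ζ L ∧ HasNTLimitExt F ζ L

end ModelSpace

end

namespace ModelSpace

open AddCircle

/-! Let `φ` and `υ` be the boundary functions of `f` and `u`, and put `q = φ * conj υ`, which equals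
`φ / υ` almost everywhere because `|υ| = 1`. Then `⟨f, u h⟩` is the integral of `q` against the
conjugate boundary function of `h`, so `f ∈ K_u` says exactly that every Fourier coefficient of `q`
of index `n ≥ 0` vanishes. Equivalently, `t ↦ q (-t)` has only coefficients of index `≥ 1`: it is
the boundary function of some `G ∈ H²` with `G 0 = 0`, and `F z = G (1 / z)` is the
pseudocontinuation.

Conversely, a pseudocontinuation has the boundary values of `f / u`, hence `q (-t)` is the boundary
function of `G`; Parseval (`integral_mul_conj_eq_zero`) then gives the orthogonality.

The analytic input is the dictionary between `H²`, square-summable Taylor coefficients and `L²`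
functions with no negative frequencies (`MemH2.exists_boundary`, `exists_memH2_of_memLp`). Its
nontangential part is Fatou's theorem (`ae_hasNTLimit`), proved by Poisson integrals at Lebesgue
points. -/

instance fact_two_pi_pos : Fact (0 < 2 * π) := ⟨Real.two_pi_pos⟩

/-! ### The unit circle parametrized by angle. -/

/-- The point of the unit circle with a given angle. -/
noncomputable def circlePt (t : AddCircle (2 * π)) : ℂ := (AddCircle.toCircle t : ℂ)

lemma norm_circlePt (t : AddCircle (2 * π)) : ‖circlePt t‖ = 1 := Circle.norm_coe _

lemma circlePt_ne_zero (t : AddCircle (2 * π)) : circlePt t ≠ 0 := Circle.coe_ne_zero _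

lemma continuous_circlePt : Continuous circlePt :=
  continuous_subtype_val.comp AddCircle.continuous_toCircle

lemma circlePt_add (s t : AddCircle (2 * π)) : circlePt (s + t) = circlePt s * circlePt t := by
  simp [circlePt, AddCircle.toCircle_add]

lemma circlePt_neg (t : AddCircle (2 * π)) : circlePt (-t) = (circlePt t)⁻¹ := by
  simp [circlePt, AddCircle.toCircle_neg]

lemma conj_circlePt (t : AddCircle (2 * π)) : conj (circlePt t) = (circlePt t)⁻¹ := by
  simp [circlePt, ← Circle.coe_inv_eq_conj]

lemma fourier_eq_zpow (n : ℤ) (t : AddCircle (2 * π)) : fourier n t = circlePt t ^ n := by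
  simp [circlePt, fourier_apply, AddCircle.toCircle_zsmul]

lemma injective_circlePt : Function.Injective circlePt :=
  Circle.coe_injective.comp (AddCircle.injective_toCircle Real.two_pi_pos.ne')

lemma measurableEmbedding_circlePt : MeasurableEmbedding circlePt :=
  (continuous_circlePt.isClosedEmbedding injective_circlePt).measurableEmbedding

lemma circleMeasure_eq_map : circleMeasure = Measure.map circlePt haarAddCircle := rfl

lemma ae_circleMeasure_iff {p : ℂ → Prop} :
    (∀ᵐ ζ ∂circleMeasure, p ζ) ↔ ∀ᵐ t ∂haarAddCircle, p (circlePt t) := by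
  rw [circleMeasure_eq_map, measurableEmbedding_circlePt.ae_map_iff]

lemma integral_circleMeasure {E : Type*} [NormedAddCommGroup E] [NormedSpace ℝ E] (g : ℂ → E) :
    ∫ ζ, g ζ ∂circleMeasure = ∫ t, g (circlePt t) ∂haarAddCircle := by
  rw [circleMeasure_eq_map, measurableEmbedding_circlePt.integral_map]

/-- Chord against arc: after rotating `t` to `0`, this is Jordan's inequality for `2 |sin (x / 2)|`.
-/
lemma dist_le_norm_circlePt_sub (s t : AddCircle (2 * π)) :
    2 / π * dist s t ≤ ‖circlePt s - circlePt t‖ := by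
  have key : ∀ v : AddCircle (2 * π), 2 / π * ‖v‖ ≤ ‖circlePt v - 1‖ := by
    intro v
    obtain ⟨x, hx, rfl⟩ : ∃ x : ℝ, |x| ≤ π ∧ (x : AddCircle (2 * π)) = v := by
      have hv := (AddCircle.equivIoc (2 * π) (-π) v).2
      refine ⟨AddCircle.equivIoc (2 * π) (-π) v, abs_le.2 ⟨hv.1.le, by linarith [hv.2]⟩, ?_⟩
      exact (AddCircle.equivIoc (2 * π) (-π)).symm_apply_apply v
    have h1 : ‖(x : AddCircle (2 * π))‖ = |x| := by
      rw [AddCircle.norm_coe_eq_abs_iff (2 * π) Real.two_pi_pos.ne', abs_of_pos Real.two_pi_pos]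
      linarith
    have h2 : circlePt (x : AddCircle (2 * π)) = Complex.exp (Complex.I * x) := by
      rw [circlePt, AddCircle.toCircle_apply_mk, div_self Real.two_pi_pos.ne', one_mul,
        Circle.coe_exp, mul_comm]
    have h3 := Real.mul_abs_le_abs_sin (x := x / 2) (by rw [abs_div, abs_two]; linarith)
    rw [h1, h2, Complex.norm_exp_I_mul_ofReal_sub_one, norm_mul, Real.norm_eq_abs,
      Real.norm_eq_abs, abs_two]
    rw [abs_div, abs_two] at h3
    linarith
  have h := key (s - t)
  have h2 : circlePt s - circlePt t = circlePt t * (circlePt (s - t) - 1) := by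
    rw [mul_sub, ← circlePt_add, mul_one]; simp
  rwa [h2, norm_mul, norm_circlePt, one_mul, dist_eq_norm]

/-! ### Dyadic majorants of kernels. -/

section Dyadic

/-- Take the least `k` with `d ≤ 2 ^ k * h`. If `k > 0`, minimality gives `d > 2 ^ (k - 1) * h`, and
`K ≤ h / d ^ 2` yields the factor `4 * 4 ^ (-k)`. -/
lemma exists_dyadic_bound {h d K : ℝ} (hh : 0 < h) (h1 : K * h ≤ 1) (h2 : K * d ^ 2 ≤ h) :
    ∃ k : ℕ, d ≤ 2 ^ k * h ∧ K ≤ 4 * (1 / 4) ^ k / h := by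
  classical
  have hex : ∃ k : ℕ, d ≤ 2 ^ k * h := by
    obtain ⟨n, hn⟩ := pow_unbounded_of_one_lt (d / h) (one_lt_two)
    exact ⟨n, by rw [div_lt_iff₀ hh] at hn; exact hn.le⟩
  refine ⟨Nat.find hex, Nat.find_spec hex, ?_⟩
  rcases hk : Nat.find hex with _ | k
  · rw [le_div_iff₀ hh]; linarith
  · have hlt : 2 ^ k * h < d := by
      have := Nat.find_min hex (m := k) (by omega)
      exact not_le.1 this
    rcases le_or_gt K 0 with hK | hK
    · exact hK.trans (by positivity)
    have h3 : (2 ^ k * h) ^ 2 ≤ d ^ 2 := pow_le_pow_left₀ (by positivity) hlt.le 2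
    have h4 : K * (4 ^ k * h) * h ≤ 1 * h := by
      calc K * (4 ^ k * h) * h = K * (2 ^ k * h) ^ 2 := by
            rw [mul_pow, ← pow_mul, mul_comm k 2, pow_mul]; norm_num; ring
        _ ≤ K * d ^ 2 := by gcongr
        _ ≤ 1 * h := by linarith
    have h5 := le_of_mul_le_mul_right h4 hh
    rw [le_div_iff₀ hh, pow_succ, div_pow, one_pow]
    field_simp
    linarith

variable {X : Type*} [PseudoMetricSpace X] [MeasurableSpace X]

/-- A weighted sum of the integrals of `ψ` over the dyadic balls `closedBall t (2 ^ k * h)`. -/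
noncomputable def dyadicMean (μ : Measure X) (ψ : X → ℝ) (t : X) (h : ℝ) : ℝ :=
  ∑' k : ℕ, 4 * (1 / 4 : ℝ) ^ k / h * ∫ s in closedBall t (2 ^ k * h), ψ s ∂μ

variable {μ : Measure X} {ψ : X → ℝ}

lemma summable_dyadicMean (hψ : Integrable ψ μ) (hψ0 : ∀ s, 0 ≤ ψ s) (t : X) {h : ℝ} (hh : 0 < h) :
    Summable fun k : ℕ => 4 * (1 / 4 : ℝ) ^ k / h * ∫ s in closedBall t (2 ^ k * h), ψ s ∂μ := by
  have hg : Summable fun k : ℕ => (1 / 4 : ℝ) ^ k * (4 / h * ∫ s, ψ s ∂μ) :=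
    (summable_geometric_of_lt_one (by norm_num) (by norm_num)).mul_right _
  refine Summable.of_nonneg_of_le (fun k => ?_) (fun k => ?_) hg
  · exact mul_nonneg (by positivity) (integral_nonneg hψ0)
  · calc 4 * (1 / 4 : ℝ) ^ k / h * ∫ s in closedBall t (2 ^ k * h), ψ s ∂μ
        ≤ 4 * (1 / 4 : ℝ) ^ k / h * ∫ s, ψ s ∂μ := by
          exact mul_le_mul_of_nonneg_left
            (setIntegral_le_integral hψ (Eventually.of_forall hψ0)) (by positivity)
      _ = _ := by ring

/-- By `exists_dyadic_bound`, `K` is dominated pointwise by a weighted sum of indicators of dyadic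
balls. With lower integrals, sum and integral commute freely. -/
lemma integral_mul_le_dyadicMean [OpensMeasurableSpace X] (hψ : Integrable ψ μ)
    (hψ0 : ∀ s, 0 ≤ ψ s) (t : X) {h : ℝ} (hh : 0 < h) {K : X → ℝ} (hK0 : ∀ s, 0 ≤ K s)
    (hKm : AEStronglyMeasurable K μ) (h1 : ∀ s, K s * h ≤ 1)
    (h2 : ∀ s, K s * dist s t ^ 2 ≤ h) :
    ∫ s, K s * ψ s ∂μ ≤ dyadicMean μ ψ t h := by
  have hsum := summable_dyadicMean hψ hψ0 t hh
  have hterm : ∀ k : ℕ, 0 ≤ 4 * (1 / 4 : ℝ) ^ k / h * ∫ s in closedBall t (2 ^ k * h), ψ s ∂μ :=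
    fun k => mul_nonneg (by positivity) (integral_nonneg hψ0)
  rw [integral_eq_lintegral_of_nonneg_ae
    (Eventually.of_forall fun s => mul_nonneg (hK0 s) (hψ0 s)) (hKm.mul hψ.1)]
  refine ENNReal.toReal_le_of_le_ofReal (tsum_nonneg hterm) ?_
  rw [dyadicMean, ENNReal.ofReal_tsum_of_nonneg hterm hsum]
  have hk : ∀ k : ℕ, ENNReal.ofReal (4 * (1 / 4 : ℝ) ^ k / h *
      ∫ s in closedBall t (2 ^ k * h), ψ s ∂μ) =
      ∫⁻ s, (closedBall t (2 ^ k * h)).indicator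
        (fun s => ENNReal.ofReal (4 * (1 / 4 : ℝ) ^ k / h) * ENNReal.ofReal (ψ s)) s ∂μ := by
    intro k
    rw [lintegral_indicator measurableSet_closedBall,
      lintegral_const_mul'' _ hψ.1.aemeasurable.ennreal_ofReal.restrict,
      ENNReal.ofReal_mul (by positivity),
      ofReal_integral_eq_lintegral_ofReal hψ.restrict (Eventually.of_forall hψ0)]
  simp_rw [hk]
  rw [← lintegral_tsum fun k => (hψ.1.aemeasurable.ennreal_ofReal.const_mul _).indicator
    measurableSet_closedBall]
  refine lintegral_mono fun s => ?_
  obtain ⟨k, hk1, hk2⟩ := exists_dyadic_bound hh (h1 s) (h2 s)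
  refine le_trans ?_ (ENNReal.le_tsum k)
  rw [Set.indicator_of_mem (mem_closedBall.2 hk1), ENNReal.ofReal_mul (hK0 s)]
  gcongr

/-- The `k`-th term is `4 * 2 ^ (-k) * A (2 ^ k * h)`, so dominated convergence for series applies
once `A` is bounded. -/
lemma tendsto_dyadicMean (hψ : Integrable ψ μ) (hψ0 : ∀ s, 0 ≤ ψ s) (t : X)
    (ht : Tendsto (fun r : ℝ => (∫ s in closedBall t r, ψ s ∂μ) / r) (𝓝[>] 0) (𝓝 0)) :
    Tendsto (dyadicMean μ ψ t) (𝓝[>] 0) (𝓝 0) := by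
  set A : ℝ → ℝ := fun r => (∫ s in closedBall t r, ψ s ∂μ) / r with hA
  have hint0 : 0 ≤ ∫ s, ψ s ∂μ := integral_nonneg hψ0
  -- The bound must hold at all radii, since `2 ^ k * h` is unbounded in `k`: small radii use the
  -- limit, large ones the total mass.
  obtain ⟨M, hM⟩ : ∃ M : ℝ, ∀ r : ℝ, 0 < r → A r ≤ M := by
    have hev : ∀ᶠ r in 𝓝[>] (0 : ℝ), A r < 1 := ht.eventually (gt_mem_nhds one_pos)
    obtain ⟨δ, hδ, hsub⟩ := mem_nhdsGT_iff_exists_Ioc_subset.1 hev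
    have hδ' : (0 : ℝ) < δ := hδ
    refine ⟨1 + (∫ s, ψ s ∂μ) / δ, fun r hr => ?_⟩
    rcases le_or_gt r δ with h | h
    · have : A r < 1 := hsub ⟨hr, h⟩
      have : 0 ≤ (∫ s, ψ s ∂μ) / δ := by positivity
      linarith
    · have : A r ≤ (∫ s, ψ s ∂μ) / δ :=
        div_le_div₀ hint0 (setIntegral_le_integral hψ (Eventually.of_forall hψ0)) hδ' h.le
      linarith
  have hlim := tendsto_tsum_of_dominated_convergence (𝓕 := 𝓝[>] (0 : ℝ))
    (f := fun h (k : ℕ) => 4 * (1 / 2 : ℝ) ^ k * A (2 ^ k * h)) (g := fun _ => (0 : ℝ))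
    (bound := fun k => 4 * (1 / 2 : ℝ) ^ k * M)
    (((summable_geometric_of_lt_one (by norm_num) (by norm_num)).mul_left 4).mul_right M)
    (fun k => by
      have h1 : Tendsto (fun h : ℝ => 2 ^ k * h) (𝓝[>] 0) (𝓝[>] 0) := by
        refine tendsto_nhdsWithin_iff.2 ⟨?_, ?_⟩
        · have : Tendsto (fun h : ℝ => 2 ^ k * h) (𝓝 0) (𝓝 (2 ^ k * 0)) :=
            (continuous_const.mul continuous_id).tendsto _
          rw [mul_zero] at this
          exact this.mono_left nhdsWithin_le_nhds
        · filter_upwards [self_mem_nhdsWithin] with h hh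
          have : (0 : ℝ) < h := hh
          exact Set.mem_Ioi.2 (by positivity)
      simpa using (ht.comp h1).const_mul (4 * (1 / 2 : ℝ) ^ k))
    (by
      filter_upwards [self_mem_nhdsWithin] with h hh k
      have hh' : (0 : ℝ) < h := hh
      have h0 : 0 ≤ A (2 ^ k * h) := div_nonneg (integral_nonneg hψ0) (by positivity)
      rw [Real.norm_of_nonneg (by positivity)]
      have := hM (2 ^ k * h) (by positivity)
      gcongr)
  rw [tsum_zero] at hlim
  refine hlim.congr' ?_
  filter_upwards [self_mem_nhdsWithin] with h hh
  have hh' : (0 : ℝ) < h := hh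
  refine tsum_congr fun k => ?_
  rw [hA, show (1 / 4 : ℝ) = 1 / 2 * (1 / 2) by norm_num, mul_pow]
  have : (1 / 2 : ℝ) ^ k * 2 ^ k = 1 := by rw [← mul_pow]; norm_num
  field_simp
  rw [this, one_mul]

end Dyadic

/-! ### Fourier expansion of the Poisson kernel. -/

lemma hasSum_integral_mul_fourier {ι : Type*} [Countable ι] {a : ι → ℂ} (ha : Summable fun i => ‖a i‖)
    (k : ι → ℤ) {φ : AddCircle (2 * π) → ℂ} (hφ : Integrable φ haarAddCircle) :
    HasSum (fun i => a i * fourierCoeff φ (k i))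
      (∫ t, φ t * ∑' i, a i * fourier (-k i) t ∂haarAddCircle) := by
  have hnorm : ∀ i t, ‖a i * (fourier (-k i) t • φ t)‖ = ‖a i‖ * ‖φ t‖ := by
    intro i t
    rw [norm_mul, norm_smul, fourier_eq_zpow, norm_zpow, norm_circlePt, one_zpow, one_mul]
  have h := hasSum_integral_of_summable_integral_norm (μ := haarAddCircle)
    (F := fun i t => a i * (fourier (-k i) t • φ t))
    (fun i => (hφ.fourier_smul _).const_mul _) (by
      simp_rw [hnorm, integral_const_mul]
      exact ha.mul_right _)
  have e1 : ∫ t, φ t * ∑' i, a i * fourier (-k i) t ∂haarAddCircle =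
      ∫ t, ∑' i, a i * (fourier (-k i) t • φ t) ∂haarAddCircle := by
    refine integral_congr_ae (Eventually.of_forall fun t => ?_)
    dsimp only
    rw [← tsum_mul_left]
    refine tsum_congr fun i => ?_
    rw [smul_eq_mul]; ring
  rw [e1]
  refine h.congr_fun fun i => ?_
  rw [integral_const_mul, fourierCoeff]

/-- The Poisson kernel of the unit disk. -/
noncomputable def poisson (z : ℂ) (s : AddCircle (2 * π)) : ℝ :=
  (1 - ‖z‖ ^ 2) / ‖circlePt s - z‖ ^ 2

lemma one_sub_norm_le (z : ℂ) (s : AddCircle (2 * π)) : 1 - ‖z‖ ≤ ‖circlePt s - z‖ := by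
  simpa [norm_circlePt] using norm_sub_norm_le (circlePt s) z

lemma poisson_nonneg {z : ℂ} (hz : ‖z‖ < 1) (s : AddCircle (2 * π)) : 0 ≤ poisson z s := by
  have : ‖z‖ ^ 2 ≤ 1 := by nlinarith [norm_nonneg z]
  exact div_nonneg (by linarith) (by positivity)

lemma continuous_poisson {z : ℂ} (hz : ‖z‖ < 1) : Continuous (poisson z) := by
  refine continuous_const.div ((continuous_circlePt.sub continuous_const).norm.pow 2) fun s => ?_
  have := one_sub_norm_le z s
  have : 0 < ‖circlePt s - z‖ := by linarith
  positivity

/-- The Fourier coefficients of the Poisson kernel, in reversed order. -/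
noncomputable def poissonCoeff (z : ℂ) (n : ℤ) : ℂ := (if 0 ≤ n then z else conj z) ^ n.natAbs

lemma summable_poissonCoeff {z : ℂ} (hz : ‖z‖ < 1) : Summable fun n => ‖poissonCoeff z n‖ := by
  have hn : ∀ n : ℤ, ‖poissonCoeff z n‖ = ‖z‖ ^ n.natAbs := by
    intro n
    rw [poissonCoeff, norm_pow]
    split_ifs <;> simp
  simp_rw [hn]
  have hg := summable_geometric_of_lt_one (norm_nonneg z) hz
  refine Summable.of_nat_of_neg_add_one (by simpa using hg) ?_
  refine ((summable_nat_add_iff 1).2 hg).congr fun n => ?_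
  congr 1

/-- The left side is the sum of the two geometric series of the Poisson kernel, over `n ≥ 0` and `n
< 0`, with `w` on the circle and `v = conj z`. -/
lemma inv_add_inv_mul_eq {w z v : ℂ} (hw : w ≠ 0) (h1 : w - z ≠ 0) (h2 : w⁻¹ - v ≠ 0) :
    (1 - z * w⁻¹)⁻¹ + (1 - v * w)⁻¹ * (v * w) = (1 - z * v) / ((w - z) * (w⁻¹ - v)) := by
  have f0 : w * w⁻¹ = 1 := mul_inv_cancel₀ hw
  have f1 : 1 - z * w⁻¹ = (w - z) * w⁻¹ := by linear_combination -f0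
  have f2 : 1 - v * w = (w⁻¹ - v) * w := by linear_combination -f0
  have g1 : (1 - z * w⁻¹)⁻¹ = w / (w - z) := by
    rw [f1, mul_inv, inv_inv, div_eq_mul_inv, mul_comm]
  have g2 : (1 - v * w)⁻¹ * (v * w) = v / (w⁻¹ - v) := by
    rw [f2, mul_comm v w, mul_inv, mul_assoc, inv_mul_cancel_left₀ hw, div_eq_mul_inv, mul_comm]
  rw [g1, g2, div_add_div _ _ h1 h2]
  congr 1
  linear_combination f0

lemma hasSum_poissonCoeff_natCast {z : ℂ} (hz : ‖z‖ < 1) (s : AddCircle (2 * π)) :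
    HasSum (fun n : ℕ => poissonCoeff z n * fourier (-(n : ℤ)) s)
      (1 - z * (circlePt s)⁻¹)⁻¹ := by
  have h1 : ‖z * (circlePt s)⁻¹‖ < 1 := by simpa [norm_circlePt] using hz
  refine (hasSum_geometric_of_norm_lt_one h1).congr_fun fun n => ?_
  rw [fourier_eq_zpow, zpow_neg, zpow_natCast, mul_pow, inv_pow]
  simp [poissonCoeff]

lemma hasSum_poissonCoeff_neg_natCast {z : ℂ} (hz : ‖z‖ < 1) (s : AddCircle (2 * π)) :
    HasSum (fun n : ℕ => poissonCoeff z (-((n : ℤ) + 1)) * fourier (-(-((n : ℤ) + 1))) s)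
      ((1 - conj z * circlePt s)⁻¹ * (conj z * circlePt s)) := by
  have h2 : ‖conj z * circlePt s‖ < 1 := by simpa [norm_circlePt] using hz
  refine ((hasSum_geometric_of_norm_lt_one h2).mul_right (conj z * circlePt s)).congr_fun
    fun n => ?_
  have e1 : ¬ (0 : ℤ) ≤ -((n : ℤ) + 1) := by omega
  have e2 : (-((n : ℤ) + 1)).natAbs = n + 1 := by omega
  have e3 : (-(-((n : ℤ) + 1))) = ((n + 1 : ℕ) : ℤ) := by push_cast; ring
  rw [poissonCoeff, if_neg e1, e2, e3, fourier_eq_zpow, zpow_natCast, ← mul_pow, pow_succ]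

lemma ofReal_poisson {z : ℂ} (s : AddCircle (2 * π)) :
    (poisson z s : ℂ) =
      (1 - z * conj z) / ((circlePt s - z) * ((circlePt s)⁻¹ - conj z)) := by
  have e : ((‖circlePt s - z‖ ^ 2 : ℝ) : ℂ) =
      (circlePt s - z) * ((circlePt s)⁻¹ - conj z) := by
    rw [← conj_circlePt, ← map_sub, Complex.mul_conj, Complex.normSq_eq_norm_sq]
  have e' : ((‖z‖ ^ 2 : ℝ) : ℂ) = z * conj z := by
    rw [Complex.mul_conj, Complex.normSq_eq_norm_sq]
  rw [poisson, Complex.ofReal_div, Complex.ofReal_sub, e, e', Complex.ofReal_one]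

lemma tsum_poissonCoeff {z : ℂ} (hz : ‖z‖ < 1) (s : AddCircle (2 * π)) :
    ∑' n, poissonCoeff z n * fourier (-n) s = poisson z s := by
  have hne : circlePt s - z ≠ 0 :=
    norm_pos_iff.1 ((sub_pos.2 hz).trans_le (one_sub_norm_le z s))
  have hne2 : (circlePt s)⁻¹ - conj z ≠ 0 := by
    rw [← conj_circlePt, ← map_sub]
    exact (map_ne_zero _).2 hne
  rw [(HasSum.of_nat_of_neg_add_one (f := fun n : ℤ => poissonCoeff z n * fourier (-n) s)
    (hasSum_poissonCoeff_natCast hz s) (hasSum_poissonCoeff_neg_natCast hz s)).tsum_eq,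
    ofReal_poisson]
  exact inv_add_inv_mul_eq (circlePt_ne_zero s) hne hne2

/-- Without negative frequencies the powers of `conj z` drop out, so the Poisson integral is a power
series in `z`. -/
lemma hasSum_integral_mul_poisson {z : ℂ} (hz : ‖z‖ < 1) {φ : AddCircle (2 * π) → ℂ}
    (hφ : Integrable φ haarAddCircle) (hneg : ∀ n : ℤ, n < 0 → fourierCoeff φ n = 0) :
    HasSum (fun n : ℕ => fourierCoeff φ n * z ^ n) (∫ s, φ s * poisson z s ∂haarAddCircle) := by
  have h := hasSum_integral_mul_fourier (summable_poissonCoeff hz) id hφ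
  simp only [id, tsum_poissonCoeff hz] at h
  rw [← (Nat.cast_injective (R := ℤ)).hasSum_iff] at h
  · refine h.congr_fun fun n => ?_
    simp [poissonCoeff, mul_comm]
  · intro n hn
    rw [hneg n, mul_zero]
    by_contra! hc
    exact hn ⟨n.toNat, by simp [hc]⟩

lemma integral_poisson {z : ℂ} (hz : ‖z‖ < 1) :
    ∫ s, (poisson z s : ℂ) ∂haarAddCircle = 1 := by
  have hc : ∀ n : ℤ, fourierCoeff (fun _ : AddCircle (2 * π) => (1 : ℂ)) n = if n = 0 then 1 else 0 := by
    intro n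
    have := congrFun (fourierCoeff_fourier (T := 2 * π) 0) n
    rw [Pi.single_apply] at this
    rw [← this]
    congr 1
    funext x
    simp
  have h := hasSum_integral_mul_poisson hz (φ := fun _ => 1) (integrable_const _) fun n hn => by
    rw [hc, if_neg hn.ne]
  simp only [one_mul, hc] at h
  have h2 := hasSum_single (f := fun n : ℕ => (if (n : ℤ) = 0 then (1 : ℂ) else 0) * z ^ n) 0
    fun n hn => by simp [hn]
  simpa using h.unique h2

/-! ### Fatou's theorem at Lebesgue points. -/

lemma ae_tendsto_setIntegral_closedBall_div {φ : AddCircle (2 * π) → ℂ}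
    (hφ : Integrable φ haarAddCircle) :
    ∀ᵐ t ∂haarAddCircle, Tendsto (fun r : ℝ =>
      (∫ s in closedBall t r, ‖φ s - φ t‖ ∂haarAddCircle) / r) (𝓝[>] 0) (𝓝 0) := by
  have hvol : (volume : Measure (AddCircle (2 * π))) = ENNReal.ofReal (2 * π) • haarAddCircle :=
    volume_eq_smul_haarAddCircle
  have hφ' : Integrable φ (volume : Measure (AddCircle (2 * π))) := by
    rw [hvol]; exact hφ.smul_measure ENNReal.ofReal_ne_top
  have h := IsUnifLocDoublingMeasure.ae_tendsto_average_norm_sub volume hφ'.locallyIntegrable 1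
  have hne : ENNReal.ofReal (2 * π) ≠ 0 := by simp [Real.pi_pos]
  rw [show ae (volume : Measure (AddCircle (2 * π))) = ae haarAddCircle by
    rw [hvol, Measure.ae_ennreal_smul_measure_eq hne]] at h
  filter_upwards [h] with t ht
  -- A ball of radius `r ≤ π` has volume `2 * r`, and volume is `2 * π` times Haar measure, so the
  -- average is `π / r` times the Haar integral.
  have h1 := (ht (l := 𝓝[>] (0 : ℝ)) (fun _ => t) id tendsto_id (by
    filter_upwards [self_mem_nhdsWithin] with r hr
    exact mem_closedBall_self (by simpa using le_of_lt hr))).const_mul (π⁻¹)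
  rw [mul_zero] at h1
  refine h1.congr' ?_
  filter_upwards [Ioc_mem_nhdsGT Real.pi_pos] with r hr
  rw [id]
  rw [setAverage_eq, measureReal_def, AddCircle.volume_closedBall, min_eq_right (by linarith [hr.2]),
    ENNReal.toReal_ofReal (by linarith [hr.1]), hvol, Measure.restrict_smul, integral_smul_measure,
    ENNReal.toReal_ofReal Real.two_pi_pos.le]
  have := hr.1
  simp only [smul_eq_mul]
  field_simp

/-- In a Stolz region the Poisson kernel is at most a constant times `min (1 / h) (h / dist s t ^
2)` with `h = 1 - ‖z‖`, so the error is controlled by a dyadic mean of `‖φ s - φ t‖`. -/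
lemma tendsto_integral_mul_poisson {φ : AddCircle (2 * π) → ℂ}
    (hφ : Integrable φ haarAddCircle) {t : AddCircle (2 * π)}
    (ht : Tendsto (fun r : ℝ => (∫ s in closedBall t r, ‖φ s - φ t‖ ∂haarAddCircle) / r)
      (𝓝[>] 0) (𝓝 0)) {α : ℝ} (hα : 1 < α) :
    Tendsto (fun z => ∫ s, φ s * poisson z s ∂haarAddCircle)
      (𝓝[stolz α (circlePt t)] (circlePt t)) (𝓝 (φ t)) := by
  -- Here `2 / π` is the chord-arc constant and `1 + α` the Stolz loss, so that `c * dist s t ≤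
  -- ‖circlePt s - z‖`.
  set c : ℝ := 2 / (π * (1 + α)) with hc
  have hc0 : 0 < c := by positivity
  have hc1 : c ≤ 1 := by
    rw [hc, div_le_one (by positivity)]
    nlinarith [Real.pi_gt_three]
  set ψ : AddCircle (2 * π) → ℝ := fun s => ‖φ s - φ t‖ with hψ
  have hψi : Integrable ψ haarAddCircle := (hφ.sub (integrable_const _)).norm
  have hψ0 : ∀ s, 0 ≤ ψ s := fun s => norm_nonneg _
  have hlim : Tendsto (fun z : ℂ => 2 / c ^ 2 * dyadicMean haarAddCircle ψ t (1 - ‖z‖))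
      (𝓝[stolz α (circlePt t)] (circlePt t)) (𝓝 0) := by
    have h1 : Tendsto (fun z : ℂ => 1 - ‖z‖) (𝓝[stolz α (circlePt t)] (circlePt t)) (𝓝[>] 0) := by
      refine tendsto_nhdsWithin_iff.2 ⟨?_, ?_⟩
      · have : Tendsto (fun z : ℂ => 1 - ‖z‖) (𝓝 (circlePt t)) (𝓝 (1 - ‖circlePt t‖)) :=
          (continuous_const.sub continuous_norm).tendsto _
        rw [norm_circlePt, sub_self] at this
        exact this.mono_left nhdsWithin_le_nhds
      · filter_upwards [self_mem_nhdsWithin] with z hz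
        exact Set.mem_Ioi.2 (sub_pos.2 hz.1)
    simpa using ((tendsto_dyadicMean hψi hψ0 t ht).comp h1).const_mul (2 / c ^ 2)
  rw [tendsto_iff_norm_sub_tendsto_zero]
  refine squeeze_zero' (Eventually.of_forall fun _ => norm_nonneg _) ?_ hlim
  filter_upwards [self_mem_nhdsWithin] with z hz
  have hz1 : ‖z‖ < 1 := hz.1
  have hh : 0 < 1 - ‖z‖ := sub_pos.2 hz1
  have hcont := continuous_poisson hz1
  have hint : ∀ {g : AddCircle (2 * π) → ℂ}, Integrable g haarAddCircle →
      Integrable (fun s => g s * (poisson z s : ℂ)) haarAddCircle := by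
    intro g hg
    obtain ⟨B, hB⟩ := isCompact_univ.exists_bound_of_continuousOn hcont.continuousOn
    refine hg.mul_bdd (c := B) (Complex.continuous_ofReal.comp hcont).aestronglyMeasurable
      (Eventually.of_forall fun s => ?_)
    rw [Complex.norm_real]
    exact hB s (Set.mem_univ s)
  have e1 : (∫ s, φ s * poisson z s ∂haarAddCircle) - φ t =
      ∫ s, (φ s - φ t) * poisson z s ∂haarAddCircle := by
    simp_rw [sub_mul]
    rw [integral_sub (hint hφ) (hint (integrable_const _)), integral_const_mul,
      integral_poisson hz1, mul_one]
  have e2 : ‖∫ s, (φ s - φ t) * poisson z s ∂haarAddCircle‖ ≤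
      ∫ s, 2 / c ^ 2 * (c ^ 2 / 2 * poisson z s * ψ s) ∂haarAddCircle := by
    refine (norm_integral_le_integral_norm _).trans_eq
      (integral_congr_ae (Eventually.of_forall fun s => ?_))
    dsimp only
    rw [norm_mul, Complex.norm_real, Real.norm_of_nonneg (poisson_nonneg hz1 s), hψ]
    field_simp
  rw [e1]
  refine e2.trans ?_
  rw [integral_const_mul]
  refine mul_le_mul_of_nonneg_left ?_ (by positivity)
  -- The factor `1 / 2` absorbs `1 - ‖z‖ ^ 2 ≤ 2 * (1 - ‖z‖)`.
  have hbound : ∀ s, c ^ 2 / 2 * poisson z s ≤ c ^ 2 * (1 - ‖z‖) / ‖circlePt s - z‖ ^ 2 := by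
    intro s
    rw [poisson, ← mul_div_assoc]
    refine div_le_div_of_nonneg_right ?_ (sq_nonneg _)
    nlinarith [mul_nonneg (sq_nonneg c) (sq_nonneg (1 - ‖z‖))]
  have hpos : ∀ s, 0 < ‖circlePt s - z‖ := fun s => hh.trans_le (one_sub_norm_le z s)
  refine integral_mul_le_dyadicMean hψi hψ0 t hh
    (fun s => mul_nonneg (by positivity) (poisson_nonneg hz1 s))
    (continuous_const.mul hcont).aestronglyMeasurable (fun s => ?_) (fun s => ?_)
  · refine (mul_le_mul_of_nonneg_right (hbound s) hh.le).trans ?_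
    have h1 := one_sub_norm_le z s
    have := hpos s
    rw [div_mul_eq_mul_div, div_le_one (by positivity), mul_assoc, ← sq]
    calc c ^ 2 * (1 - ‖z‖) ^ 2 ≤ 1 ^ 2 * ‖circlePt s - z‖ ^ 2 := by gcongr
      _ = _ := by ring
  · refine (mul_le_mul_of_nonneg_right (hbound s) (sq_nonneg _)).trans ?_
    have := hpos s
    have h2 : c * dist s t ≤ ‖circlePt s - z‖ := by
      have h3 := dist_le_norm_circlePt_sub s t
      have h4 : ‖circlePt s - circlePt t‖ ≤ ‖circlePt s - z‖ + ‖z - circlePt t‖ :=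
        norm_sub_le_norm_sub_add_norm_sub _ _ _
      have h5 := hz.2
      have h6 := one_sub_norm_le z s
      have h7 : ‖circlePt s - circlePt t‖ ≤ (1 + α) * ‖circlePt s - z‖ := by nlinarith
      have h8 : c * dist s t = (2 / π * dist s t) / (1 + α) := by rw [hc]; field_simp
      rw [h8, div_le_iff₀ (by positivity)]
      linarith
    rw [div_mul_eq_mul_div, div_le_iff₀ (by positivity)]
    calc c ^ 2 * (1 - ‖z‖) * dist s t ^ 2 = (1 - ‖z‖) * (c * dist s t) ^ 2 := by ring
      _ ≤ (1 - ‖z‖) * ‖circlePt s - z‖ ^ 2 := by gcongr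

/-- Fatou's theorem for analytic functions whose Taylor coefficients are the Fourier coefficients
of an integrable function. -/
lemma ae_hasNTLimit {φ : AddCircle (2 * π) → ℂ} (hφ : Integrable φ haarAddCircle)
    (hneg : ∀ n : ℤ, n < 0 → fourierCoeff φ n = 0) {f : ℂ → ℂ}
    (hf : ∀ z : ℂ, ‖z‖ < 1 → HasSum (fun n : ℕ => fourierCoeff φ n * z ^ n) (f z)) :
    ∀ᵐ t ∂haarAddCircle, HasNTLimit f (circlePt t) (φ t) := by
  filter_upwards [ae_tendsto_setIntegral_closedBall_div hφ] with t ht α hα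
  refine (tendsto_integral_mul_poisson hφ ht hα).congr' ?_
  filter_upwards [self_mem_nhdsWithin] with z hz
  exact (hasSum_integral_mul_poisson hz.1 hφ hneg).unique (hf z hz.1)

/-! ### `H²` through square-summable Taylor coefficients. -/

section Coefficients

variable {f : ℂ → ℂ} {c : ℕ → ℂ}

lemma exists_taylorCoeff (hd : DifferentiableOn ℂ f (ball 0 1)) :
    ∃ c : ℕ → ℂ, ∀ z : ℂ, ‖z‖ < 1 → HasSum (fun n => c n * z ^ n) (f z) := by
  refine ⟨fun n => (n.factorial : ℂ)⁻¹ * iteratedDeriv n f 0, fun z hz => ?_⟩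
  refine (Complex.hasSum_taylorSeries_on_ball (r := 1) (by simpa using hd) (z := z)
    (by simpa using hz)).congr_fun fun n => ?_
  simp only [smul_eq_mul, sub_zero]
  ring

lemma eq_taylorCoeff_zero (hf : ∀ z : ℂ, ‖z‖ < 1 → HasSum (fun n => c n * z ^ n) (f z)) :
    f 0 = c 0 := by
  have h := hasSum_single (f := fun n : ℕ => c n * (0 : ℂ) ^ n) 0 fun n hn => by simp [hn]
  simpa using (hf 0 (by simp)).unique h

lemma fourierCoeff_circle (hf : ∀ z : ℂ, ‖z‖ < 1 → HasSum (fun n => c n * z ^ n) (f z))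
    {r : ℝ} (hr0 : 0 ≤ r) (hr1 : r < 1) (m : ℤ) :
    HasSum (fun n : ℕ => if (n : ℤ) = m then c n * (r : ℂ) ^ n else 0)
      (fourierCoeff (fun t : AddCircle (2 * π) => f (r * circlePt t)) m) := by
  have hs : Summable fun n => ‖c n * (r : ℂ) ^ n‖ :=
    (hf r (by rwa [Complex.norm_real, Real.norm_of_nonneg hr0])).summable.norm
  have h := hasSum_integral_mul_fourier hs (fun n => -(n : ℤ))
    (φ := fun t => fourier (-m) t)
    ((map_continuous (fourier (-m))).integrable_of_hasCompactSupport
      (HasCompactSupport.of_compactSpace _))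
  have e : ∫ t, fourier (-m) t * ∑' n : ℕ, c n * (r : ℂ) ^ n * fourier (-(-(n : ℤ))) t
      ∂(haarAddCircle (T := 2 * π)) =
      fourierCoeff (fun t : AddCircle (2 * π) => f (r * circlePt t)) m := by
    refine integral_congr_ae (Eventually.of_forall fun t => ?_)
    dsimp only
    rw [smul_eq_mul, ← (hf (r * circlePt t) (by
      rwa [norm_mul, norm_circlePt, mul_one, Complex.norm_real, Real.norm_of_nonneg hr0])).tsum_eq]
    congr 1
    refine tsum_congr fun n => ?_
    rw [neg_neg, fourier_eq_zpow, zpow_natCast, mul_pow, mul_assoc]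
  rw [e] at h
  refine h.congr_fun fun n => ?_
  have := congrFun (fourierCoeff_fourier (T := 2 * π) (-m)) (-(n : ℤ))
  rw [this, Pi.single_apply]
  simp

/-- Parseval on the circle of radius `r`, where only the indices `n ≥ 0` contribute. -/
lemma hasSum_integral_circle (hd : DifferentiableOn ℂ f (ball 0 1))
    (hf : ∀ z : ℂ, ‖z‖ < 1 → HasSum (fun n => c n * z ^ n) (f z))
    {r : ℝ} (hr0 : 0 ≤ r) (hr1 : r < 1) :
    HasSum (fun n => ‖c n‖ ^ 2 * r ^ (2 * n)) (∫ ζ, ‖f (r * ζ)‖ ^ 2 ∂circleMeasure) := by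
  have hcont : Continuous fun t : AddCircle (2 * π) => f (r * circlePt t) := by
    refine hd.continuousOn.comp_continuous (continuous_const.mul continuous_circlePt) fun t => ?_
    rwa [mem_ball_zero_iff, norm_mul, norm_circlePt, mul_one, Complex.norm_real,
      Real.norm_of_nonneg hr0]
  set g : C(AddCircle (2 * π), ℂ) := ⟨_, hcont⟩ with hg
  have h := hasSum_sq_fourierCoeff (ContinuousMap.toLp 2 haarAddCircle ℂ g)
  have e1 : ∫ t, ‖ContinuousMap.toLp 2 haarAddCircle ℂ g t‖ ^ 2 ∂haarAddCircle =
      ∫ ζ, ‖f (r * ζ)‖ ^ 2 ∂circleMeasure := by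
    rw [integral_circleMeasure]
    refine integral_congr_ae ?_
    filter_upwards [ContinuousMap.coeFn_toLp (p := 2) (𝕜 := ℂ) haarAddCircle g] with t ht
    rw [ht]; rfl
  simp_rw [fourierCoeff_toLp] at h
  rw [e1, ← (Nat.cast_injective (R := ℤ)).hasSum_iff] at h
  · refine h.congr_fun fun n => ?_
    have h1 := fourierCoeff_circle hf hr0 hr1 (n : ℤ)
    have h2 := hasSum_single (f := fun k : ℕ => if (k : ℤ) = n then c k * (r : ℂ) ^ k else 0) n
      fun k hk => by simp [hk]
    have h3 := h1.unique h2
    rw [if_pos rfl] at h3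
    have h4 : fourierCoeff g (n : ℤ) = c n * (r : ℂ) ^ n := h3
    rw [Function.comp_apply, h4, norm_mul, norm_pow, Complex.norm_real, Real.norm_of_nonneg hr0]
    ring
  · intro m hm
    have h1 := fourierCoeff_circle hf hr0 hr1 m
    have h2 : HasSum (fun k : ℕ => if (k : ℤ) = m then c k * (r : ℂ) ^ k else 0) 0 := by
      refine hasSum_zero.congr_fun fun k => if_neg fun hk => hm ⟨k, hk⟩
    have h4 : fourierCoeff g m = 0 := h1.unique h2
    rw [h4]; simp

lemma eventually_mem_Ioo : ∀ᶠ r : ℝ in 𝓝[<] 1, 0 < r ∧ r < 1 :=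
  Ioo_mem_nhdsLT zero_lt_one

/-- Each finite partial sum is bounded by the means; let `r → 1` with the number of terms fixed. -/
lemma summable_sq_taylorCoeff (hd : DifferentiableOn ℂ f (ball 0 1))
    (hf : ∀ z : ℂ, ‖z‖ < 1 → HasSum (fun n => c n * z ^ n) (f z)) {C : ℝ}
    (hC : ∀ᶠ r : ℝ in 𝓝[<] 1, ∫ ζ, ‖f (r * ζ)‖ ^ 2 ∂circleMeasure ≤ C) :
    Summable fun n => ‖c n‖ ^ 2 := by
  refine summable_of_sum_range_le (c := C) (fun n => by positivity) fun N => ?_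
  have hlim : Tendsto (fun r : ℝ => ∑ n ∈ Finset.range N, ‖c n‖ ^ 2 * r ^ (2 * n)) (𝓝[<] 1)
      (𝓝 (∑ n ∈ Finset.range N, ‖c n‖ ^ 2 * 1 ^ (2 * n))) :=
    (Continuous.tendsto (by fun_prop) 1).mono_left nhdsWithin_le_nhds
  simp only [one_pow, mul_one] at hlim
  refine le_of_tendsto hlim ?_
  filter_upwards [hC, eventually_mem_Ioo] with r hr hr1
  exact (sum_le_hasSum _ (fun n _ => by have := hr1.1; positivity)
    (hasSum_integral_circle hd hf hr1.1.le hr1.2)).trans hr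

lemma memH2_of_summable (hd : DifferentiableOn ℂ f (ball 0 1))
    (hf : ∀ z : ℂ, ‖z‖ < 1 → HasSum (fun n => c n * z ^ n) (f z))
    (hc : Summable fun n => ‖c n‖ ^ 2) : MemH2 f := by
  refine ⟨hd, ∑' n, ‖c n‖ ^ 2, ?_⟩
  have h := tendsto_tsum_of_dominated_convergence (𝓕 := 𝓝[<] (1 : ℝ))
    (f := fun r n => ‖c n‖ ^ 2 * r ^ (2 * n)) (g := fun n => ‖c n‖ ^ 2) hc
    (fun n => by
      have : Tendsto (fun r : ℝ => ‖c n‖ ^ 2 * r ^ (2 * n)) (𝓝[<] 1) (𝓝 (‖c n‖ ^ 2 * 1 ^ (2 * n))) :=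
        (Continuous.tendsto (by fun_prop) 1).mono_left nhdsWithin_le_nhds
      simpa using this)
    (by
      filter_upwards [eventually_mem_Ioo] with r hr n
      have := hr.1
      rw [Real.norm_of_nonneg (by positivity)]
      exact mul_le_of_le_one_right (by positivity) (pow_le_one₀ hr.1.le hr.2.le))
  refine h.congr' ?_
  filter_upwards [eventually_mem_Ioo] with r hr
  exact (hasSum_integral_circle hd hf hr.1.le hr.2).tsum_eq

lemma MemH2.summable_sq (h : MemH2 f)
    (hf : ∀ z : ℂ, ‖z‖ < 1 → HasSum (fun n => c n * z ^ n) (f z)) :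
    Summable fun n => ‖c n‖ ^ 2 := by
  obtain ⟨L, hL⟩ := h.2
  exact summable_sq_taylorCoeff h.1 hf
    ((hL.eventually (gt_mem_nhds (lt_add_one L))).mono fun r hr => le_of_lt hr)

lemma memH2_of_bounded (hd : DifferentiableOn ℂ f (ball 0 1)) {C : ℝ}
    (hC : ∀ z ∈ ball (0 : ℂ) 1, ‖f z‖ ≤ C) : MemH2 f := by
  obtain ⟨c, hc⟩ := exists_taylorCoeff hd
  refine memH2_of_summable hd hc (summable_sq_taylorCoeff hd hc (C := C ^ 2) ?_)
  filter_upwards [eventually_mem_Ioo] with r hr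
  rw [integral_circleMeasure]
  have hb : ∀ t : AddCircle (2 * π), ‖‖f (r * circlePt t)‖ ^ 2‖ ≤ C ^ 2 := by
    intro t
    rw [Real.norm_of_nonneg (by positivity)]
    refine pow_le_pow_left₀ (norm_nonneg _) (hC _ ?_) 2
    rw [mem_ball_zero_iff, norm_mul, norm_circlePt, mul_one, Complex.norm_real,
      Real.norm_of_nonneg hr.1.le]
    exact hr.2
  refine (le_abs_self _).trans ?_
  simpa using norm_integral_le_of_norm_le_const (μ := haarAddCircle) (Eventually.of_forall hb)

/-- Square-summable coefficients are bounded, so a geometric series majorizes the power series on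
each smaller disk. -/
lemma exists_memH2_of_summable (hc : Summable fun n => ‖c n‖ ^ 2) :
    ∃ f : ℂ → ℂ, MemH2 f ∧ ∀ z : ℂ, ‖z‖ < 1 → HasSum (fun n => c n * z ^ n) (f z) := by
  obtain ⟨B, hB⟩ : ∃ B : ℝ, ∀ n, ‖c n‖ ≤ B := by
    refine ⟨1 + ∑' n, ‖c n‖ ^ 2, fun n => ?_⟩
    have h1 : ‖c n‖ ^ 2 ≤ ∑' n, ‖c n‖ ^ 2 := hc.le_tsum n fun _ _ => by positivity
    nlinarith [sq_nonneg (‖c n‖ - 1)]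
  have hsum : ∀ ρ : ℝ, 0 ≤ ρ → ρ < 1 → Summable fun n : ℕ => B * ρ ^ n := fun ρ h0 h1 =>
    (summable_geometric_of_lt_one h0 h1).mul_left B
  have hle : ∀ (n : ℕ) (z : ℂ) (ρ : ℝ), ‖z‖ ≤ ρ → ‖c n * z ^ n‖ ≤ B * ρ ^ n := by
    intro n z ρ hz
    rw [norm_mul, norm_pow]
    exact mul_le_mul (hB n) (pow_le_pow_left₀ (norm_nonneg _) hz n) (by positivity)
      ((norm_nonneg _).trans (hB n))
  have hf : ∀ z : ℂ, ‖z‖ < 1 → HasSum (fun n => c n * z ^ n) (∑' n, c n * z ^ n) := fun z hz =>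
    (Summable.of_norm_bounded (hsum _ (norm_nonneg z) hz) fun n => hle n z _ le_rfl).hasSum
  refine ⟨fun z => ∑' n, c n * z ^ n, memH2_of_summable ?_ hf hc, hf⟩
  intro z hz
  rw [mem_ball_zero_iff] at hz
  obtain ⟨ρ, h1, h2⟩ := exists_between hz
  have hd := Complex.differentiableOn_tsum_of_summable_norm (F := fun (n : ℕ) (z : ℂ) => c n * z ^ n)
    (hsum ρ ((norm_nonneg z).trans h1.le) h2) (fun n => by fun_prop) (isOpen_ball (x := 0) (ε := ρ))
    fun n w hw => hle n w ρ (mem_ball_zero_iff.1 hw).le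
  exact ((hd z (mem_ball_zero_iff.2 h1)).differentiableAt
    (isOpen_ball.mem_nhds (mem_ball_zero_iff.2 h1))).differentiableWithinAt

end Coefficients

/-! ### Boundary functions in `L²`. -/

section Boundary

/-- Riesz–Fischer, after extending the sequence by zero to negative indices. -/
lemma exists_memLp_fourierCoeff {c : ℕ → ℂ} (hc : Summable fun n => ‖c n‖ ^ 2) :
    ∃ φ : AddCircle (2 * π) → ℂ, MemLp φ 2 haarAddCircle ∧ (∀ n : ℕ, fourierCoeff φ n = c n) ∧
      ∀ n : ℤ, n < 0 → fourierCoeff φ n = 0 := by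
  set a : ℤ → ℂ := fun n => if 0 ≤ n then c n.toNat else 0 with ha
  have hmem : Memℓp a 2 := by
    refine memℓp_gen ?_
    refine Summable.of_nat_of_neg_add_one ?_ ?_
    · simpa [ha] using hc
    · refine summable_zero.congr fun n => ?_
      have e1 : ¬ (0 : ℤ) ≤ -((n : ℤ) + 1) := by omega
      simp only [ha, if_neg e1]
      simp
  have hrep : ∀ n, fourierCoeff (fourierBasis (T := 2 * π).repr.symm ⟨a, hmem⟩) n = a n := by
    intro n
    rw [← fourierBasis_repr, LinearIsometryEquiv.apply_symm_apply]
  refine ⟨_, Lp.memLp (fourierBasis (T := 2 * π).repr.symm ⟨a, hmem⟩), fun n => ?_, fun n hn => ?_⟩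
  · rw [hrep]; simp [ha]
  · rw [hrep]; simp [ha, hn]

/-- Boundary values of functions in `H²`. -/
lemma MemH2.exists_boundary {f : ℂ → ℂ} (hf : MemH2 f) :
    ∃ φ : AddCircle (2 * π) → ℂ, MemLp φ 2 haarAddCircle ∧ fourierCoeff φ 0 = f 0 ∧
      (∀ n : ℤ, n < 0 → fourierCoeff φ n = 0) ∧
      ∀ᵐ t ∂haarAddCircle, HasNTLimit f (circlePt t) (φ t) := by
  obtain ⟨c, hc⟩ := exists_taylorCoeff hf.1
  obtain ⟨φ, hφ, hφc, hneg⟩ := exists_memLp_fourierCoeff (hf.summable_sq hc)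
  refine ⟨φ, hφ, ?_, hneg, ae_hasNTLimit (hφ.integrable (by norm_num)) hneg fun z hz => ?_⟩
  · rw [eq_taylorCoeff_zero hc]; exact hφc 0
  · simpa only [hφc] using hc z hz

/-- A square-integrable function without negative Fourier coefficients is the boundary function
of a function in `H²`. -/
lemma exists_memH2_of_memLp {φ : AddCircle (2 * π) → ℂ} (hφ : MemLp φ 2 haarAddCircle)
    (hneg : ∀ n : ℤ, n < 0 → fourierCoeff φ n = 0) :
    ∃ f : ℂ → ℂ, MemH2 f ∧ f 0 = fourierCoeff φ 0 ∧
      ∀ᵐ t ∂haarAddCircle, HasNTLimit f (circlePt t) (φ t) := by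
  have hs := (hasSum_sq_fourierCoeff hφ.toLp).summable
  rw [fourierCoeff_congr_ae hφ.coeFn_toLp] at hs
  obtain ⟨f, hf, hfc⟩ := exists_memH2_of_summable (c := fun n : ℕ => fourierCoeff φ n)
    (hs.comp_injective (Nat.cast_injective (R := ℤ)))
  exact ⟨f, hf, eq_taylorCoeff_zero hfc, ae_hasNTLimit (hφ.integrable (by norm_num)) hneg hfc⟩

/-- Parseval: with disjoint spectra every term of the inner product series is zero. -/
lemma integral_mul_conj_eq_zero {φ ψ : AddCircle (2 * π) → ℂ} (hφ : MemLp φ 2 haarAddCircle)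
    (hψ : MemLp ψ 2 haarAddCircle)
    (h : ∀ n : ℤ, fourierCoeff φ n = 0 ∨ fourierCoeff ψ n = 0) :
    ∫ t, φ t * conj (ψ t) ∂haarAddCircle = 0 := by
  have h1 := fourierBasis.hasSum_inner_mul_inner hψ.toLp hφ.toLp
  have h2 : HasSum (fun i => inner ℂ hψ.toLp (fourierBasis i) * inner ℂ (fourierBasis i) hφ.toLp)
      (0 : ℂ) := by
    refine hasSum_zero.congr_fun fun n => ?_
    rw [← inner_conj_symm, ← HilbertBasis.repr_apply_apply, ← HilbertBasis.repr_apply_apply,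
      fourierBasis_repr, fourierBasis_repr, fourierCoeff_congr_ae hφ.coeFn_toLp,
      fourierCoeff_congr_ae hψ.coeFn_toLp]
    rcases h n with h | h <;> simp [h]
  rw [← h1.unique h2, L2.inner_def]
  refine integral_congr_ae ?_
  filter_upwards [hφ.coeFn_toLp, hψ.coeFn_toLp] with t ht1 ht2
  rw [ht1, ht2, RCLike.inner_apply]

end Boundary

/-! ### Radial limits, Stolz regions and inversion. -/

lemma tendsto_radial_stolz {ζ : ℂ} (hζ : ‖ζ‖ = 1) :
    Tendsto (fun r : ℝ => (r : ℂ) * ζ) (𝓝[<] 1) (𝓝[stolz 2 ζ] ζ) := by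
  refine tendsto_nhdsWithin_iff.2 ⟨?_, ?_⟩
  · have : Tendsto (fun r : ℝ => (r : ℂ) * ζ) (𝓝[<] 1) (𝓝 (((1 : ℝ) : ℂ) * ζ)) :=
      (Continuous.tendsto (by fun_prop) 1).mono_left nhdsWithin_le_nhds
    simpa using this
  · filter_upwards [eventually_mem_Ioo] with r hr
    have h1 : ‖(r : ℂ) * ζ‖ = r := by
      rw [norm_mul, hζ, mul_one, Complex.norm_real, Real.norm_of_nonneg hr.1.le]
    have h2 : ‖(r : ℂ) * ζ - ζ‖ = 1 - r := by
      rw [show (r : ℂ) * ζ - ζ = ((r - 1 : ℝ) : ℂ) * ζ by push_cast; ring, norm_mul, hζ, mul_one,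
        Complex.norm_real, Real.norm_eq_abs, abs_sub_comm, abs_of_pos (sub_pos.2 hr.2)]
    refine ⟨by rw [h1]; exact hr.2, ?_⟩
    rw [h1, h2]
    linarith [hr.2]

lemma HasNTLimit.tendsto_radial {f : ℂ → ℂ} {ζ L : ℂ} (h : HasNTLimit f ζ L) (hζ : ‖ζ‖ = 1) :
    Tendsto (fun r : ℝ => f (r * ζ)) (𝓝[<] 1) (𝓝 L) :=
  (h 2 one_lt_two).comp (tendsto_radial_stolz hζ)

/-- Inversion divides both sides of the Stolz inequality by `‖z‖`, so the aperture is unchanged. -/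
lemma mem_stolz_inv {α : ℝ} {z ζ : ℂ} (hζ : ‖ζ‖ = 1) (hz : z ∈ stolzExt α ζ) :
    z⁻¹ ∈ stolz α ζ⁻¹ := by
  have hz1 : 1 < ‖z‖ := hz.1
  have hz0 : 0 < ‖z‖ := one_pos.trans hz1
  have hzne : z ≠ 0 := norm_pos_iff.1 hz0
  have hζne : ζ ≠ 0 := norm_pos_iff.1 (hζ ▸ one_pos)
  refine ⟨by rw [norm_inv]; exact inv_lt_one_of_one_lt₀ hz1, ?_⟩
  have e1 : z⁻¹ - ζ⁻¹ = -((z - ζ) * z⁻¹ * ζ⁻¹) := by field_simp; ring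
  have e2 : α * (1 - ‖z⁻¹‖) = α * (‖z‖ - 1) * ‖z‖⁻¹ := by rw [norm_inv]; field_simp
  rw [e1, e2, norm_neg, norm_mul, norm_mul, norm_inv, norm_inv, hζ, inv_one, mul_one]
  exact mul_lt_mul_of_pos_right hz.2 (inv_pos.2 hz0)

lemma mem_stolzExt_inv {α : ℝ} {z ζ : ℂ} (hζ : ‖ζ‖ = 1) (hz0 : z ≠ 0) (hz : z ∈ stolz α ζ) :
    z⁻¹ ∈ stolzExt α ζ⁻¹ := by
  have hz1 : ‖z‖ < 1 := hz.1
  have hpos : 0 < ‖z‖ := norm_pos_iff.2 hz0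
  have hζne : ζ ≠ 0 := norm_pos_iff.1 (hζ ▸ one_pos)
  refine ⟨by rw [norm_inv]; exact (one_lt_inv₀ hpos).2 hz1, ?_⟩
  have e1 : z⁻¹ - ζ⁻¹ = -((z - ζ) * z⁻¹ * ζ⁻¹) := by field_simp; ring
  have e2 : α * (‖z⁻¹‖ - 1) = α * (1 - ‖z‖) * ‖z‖⁻¹ := by rw [norm_inv]; field_simp
  rw [e1, e2, norm_neg, norm_mul, norm_mul, norm_inv, norm_inv, hζ, inv_one, mul_one]
  exact mul_lt_mul_of_pos_right hz.2 (inv_pos.2 hpos)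

/-- The vertex moves to `ζ⁻¹`; this is why boundary functions get reflected by `t ↦ -t`. -/
lemma HasNTLimit.ext {g : ℂ → ℂ} {F : OnePoint ℂ → ℂ} {ζ L : ℂ} (hζ : ‖ζ‖ = 1)
    (hF : ∀ z : ℂ, 1 < ‖z‖ → F (z : OnePoint ℂ) = g (1 / z)) (h : HasNTLimit g ζ⁻¹ L) :
    HasNTLimitExt F ζ L := by
  intro α hα
  have hζne : ζ ≠ 0 := norm_pos_iff.1 (hζ ▸ one_pos)
  have h1 : Tendsto (fun z : ℂ => z⁻¹) (𝓝[stolzExt α ζ] ζ) (𝓝[stolz α ζ⁻¹] ζ⁻¹) := by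
    refine tendsto_nhdsWithin_iff.2 ⟨(tendsto_inv₀ hζne).mono_left nhdsWithin_le_nhds, ?_⟩
    filter_upwards [self_mem_nhdsWithin] with z hz using mem_stolz_inv hζ hz
  refine ((h α hα).comp h1).congr' ?_
  filter_upwards [self_mem_nhdsWithin] with z hz
  rw [hF z hz.1, one_div, Function.comp_apply]

lemma HasNTLimitExt.tendsto_radial {g : ℂ → ℂ} {F : OnePoint ℂ → ℂ} {ζ L : ℂ} (hζ : ‖ζ‖ = 1)
    (hF : ∀ z : ℂ, 1 < ‖z‖ → F (z : OnePoint ℂ) = g (1 / z)) (h : HasNTLimitExt F ζ L) :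
    Tendsto (fun r : ℝ => g (r * ζ⁻¹)) (𝓝[<] 1) (𝓝 L) := by
  have hζi : ‖ζ⁻¹‖ = 1 := by rw [norm_inv, hζ, inv_one]
  have hζne : ζ⁻¹ ≠ 0 := norm_pos_iff.1 (hζi ▸ one_pos)
  have h1 : Tendsto (fun r : ℝ => ((r : ℂ) * ζ⁻¹)⁻¹) (𝓝[<] 1) (𝓝[stolzExt 2 ζ] ζ) := by
    have hr := tendsto_nhdsWithin_iff.1 (tendsto_radial_stolz hζi)
    refine tendsto_nhdsWithin_iff.2 ⟨by simpa using hr.1.inv₀ hζne, ?_⟩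
    filter_upwards [hr.2, eventually_mem_Ioo] with r hr1 hr2
    have := mem_stolzExt_inv hζi (mul_ne_zero (Complex.ofReal_ne_zero.2 hr2.1.ne') hζne) hr1
    rwa [inv_inv] at this
  refine ((h 2 one_lt_two).comp h1).congr' ?_
  filter_upwards [(tendsto_nhdsWithin_iff.1 h1).2] with r hr
  rw [Function.comp_apply, hF _ hr.1, one_div, inv_inv]

lemma HasNTLimit.boundaryValue_eq {f : ℂ → ℂ} {ζ L : ℂ} (h : HasNTLimit f ζ L) (hζ : ‖ζ‖ = 1) :
    boundaryValue f ζ = L :=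
  (h.tendsto_radial hζ).limUnder_eq

lemma HasNTLimit.mul {f g : ℂ → ℂ} {ζ L M : ℂ} (hf : HasNTLimit f ζ L) (hg : HasNTLimit g ζ M) :
    HasNTLimit (fun z => f z * g z) ζ (L * M) :=
  fun α hα => (hf α hα).mul (hg α hα)

lemma HasNTLimit.div {f g : ℂ → ℂ} {ζ L M : ℂ} (hf : HasNTLimit f ζ L) (hg : HasNTLimit g ζ M)
    (hM : M ≠ 0) : HasNTLimit (fun z => f z / g z) ζ (L / M) :=
  fun α hα => (hf α hα).div (hg α hα) hM

/-! ### Reflection of the circle; boundary functions of inner functions. -/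

lemma integral_comp_neg (g : AddCircle (2 * π) → ℂ) :
    ∫ t, g (-t) ∂haarAddCircle = ∫ t, g t ∂haarAddCircle :=
  integral_neg_eq_self g haarAddCircle

lemma fourierCoeff_comp_neg (φ : AddCircle (2 * π) → ℂ) (n : ℤ) :
    fourierCoeff (fun t => φ (-t)) n = fourierCoeff φ (-n) := by
  rw [fourierCoeff, ← integral_comp_neg, fourierCoeff]
  refine integral_congr_ae (Eventually.of_forall fun t => ?_)
  simp only [fourier_eq_zpow, circlePt_neg, neg_neg, inv_zpow, zpow_neg, inv_inv]

lemma measurePreserving_neg_haarAddCircle :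
    MeasurePreserving (fun t : AddCircle (2 * π) => -t) haarAddCircle haarAddCircle :=
  Measure.measurePreserving_neg haarAddCircle

lemma IsInner.memH2 {u : ℂ → ℂ} (hu : IsInner u) : MemH2 u := by
  obtain ⟨C, hC⟩ := hu.2.1
  exact memH2_of_bounded hu.1 hC

/-- The boundary function of an inner function. -/
lemma IsInner.exists_boundary {u : ℂ → ℂ} (hu : IsInner u) :
    ∃ υ : AddCircle (2 * π) → ℂ, MemLp υ ⊤ haarAddCircle ∧
      ∀ᵐ t ∂haarAddCircle, HasNTLimit u (circlePt t) (υ t) ∧ ‖υ t‖ = 1 := by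
  obtain ⟨υ, hυ, -, -, hlim⟩ := hu.memH2.exists_boundary
  have h : ∀ᵐ t ∂haarAddCircle, HasNTLimit u (circlePt t) (υ t) ∧ ‖υ t‖ = 1 := by
    filter_upwards [hlim, ae_circleMeasure_iff.1 hu.2.2] with t ht ⟨L, hL, hL'⟩
    refine ⟨ht, ?_⟩
    rw [tendsto_nhds_unique (ht.tendsto_radial (norm_circlePt t)) hL', hL]
  exact ⟨υ, memLp_top_of_bound hυ.1 1 (h.mono fun t ht => ht.2.le), h⟩

lemma innerH2_eq_integral {f u h : ℂ → ℂ} {φ υ η : AddCircle (2 * π) → ℂ}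
    (hf : ∀ᵐ t ∂haarAddCircle, HasNTLimit f (circlePt t) (φ t))
    (hu : ∀ᵐ t ∂haarAddCircle, HasNTLimit u (circlePt t) (υ t) ∧ ‖υ t‖ = 1)
    (hh : ∀ᵐ t ∂haarAddCircle, HasNTLimit h (circlePt t) (η t)) :
    innerH2 f (fun z => u z * h z) =
      ∫ t, φ t * conj (υ t) * conj (η t) ∂haarAddCircle := by
  rw [innerH2, integral_circleMeasure]
  refine integral_congr_ae ?_
  filter_upwards [hf, hu, hh] with t h1 h2 h3
  rw [h1.boundaryValue_eq (norm_circlePt t),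
    (h2.1.mul h3).boundaryValue_eq (norm_circlePt t), map_mul, mul_assoc]

lemma memH2_pow (n : ℕ) : MemH2 fun z => z ^ n := by
  refine memH2_of_bounded (C := 1) (by fun_prop) fun z hz => ?_
  rw [norm_pow]
  exact pow_le_one₀ (norm_nonneg z) (mem_ball_zero_iff.1 hz).le

lemma div_eq_mul_conj {a b : ℂ} (hb : ‖b‖ = 1) : a / b = a * conj b := by
  rw [div_eq_mul_inv, Complex.inv_eq_conj hb]

lemma memLp_mul_conj {φ υ : AddCircle (2 * π) → ℂ} (hφ : MemLp φ 2 haarAddCircle)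
    (hυ : MemLp υ ⊤ haarAddCircle) : MemLp (fun t => φ t * conj (υ t)) 2 haarAddCircle :=
  hυ.star.mul hφ

/-! ### The two implications. -/

lemma exists_pseudocontinuation {u f : ℂ → ℂ} (hu : IsInner u) (hf : f ∈ modelSpace u) :
    ∃ F : OnePoint ℂ → ℂ, MemH2Ext F ∧ IsPseudocontinuation (fun z => f z / u z) F ∧
      F OnePoint.infty = 0 := by
  obtain ⟨φ, hφ, -, -, hφlim⟩ := hf.1.exists_boundary
  obtain ⟨υ, hυ, hυlim⟩ := hu.exists_boundary
  set q : AddCircle (2 * π) → ℂ := fun t => φ t * conj (υ t) with hq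
  -- Monomials suffice as test functions: `⟨f, u z ^ n⟩` is the `n`-th Fourier coefficient of `q`.
  have hcoeff : ∀ n : ℕ, fourierCoeff q n = 0 := by
    intro n
    have hpow : ∀ᵐ t ∂haarAddCircle, HasNTLimit (fun z => z ^ n) (circlePt t) (circlePt t ^ n) :=
      Eventually.of_forall fun t α _ => ((continuous_pow n).tendsto _).mono_left nhdsWithin_le_nhds
    rw [← hf.2 _ (memH2_pow n), innerH2_eq_integral hφlim hυlim hpow]
    refine integral_congr_ae (Eventually.of_forall fun t => ?_)
    simp only [smul_eq_mul, hq]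
    rw [fourier_eq_zpow, zpow_neg, zpow_natCast, map_pow, conj_circlePt, inv_pow]
    ring
  -- Reflection carries the surviving negative frequencies of `q` to positive ones, as `H²`
  -- requires.
  have hq2 : MemLp (fun t => q (-t)) 2 haarAddCircle :=
    (memLp_mul_conj hφ hυ).comp_measurePreserving measurePreserving_neg_haarAddCircle
  obtain ⟨G, hG, hG0, hGlim⟩ := exists_memH2_of_memLp hq2 fun n hn => by
    rw [fourierCoeff_comp_neg]
    obtain ⟨k, rfl⟩ := Int.exists_eq_neg_ofNat hn.le
    rw [neg_neg]; exact hcoeff k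
  -- The vanishing at index `0`, from testing against `h = 1`, is what gives `F ∞ = 0`.
  have hG0' : G 0 = 0 := by
    rw [hG0, fourierCoeff_comp_neg, neg_zero]; exact hcoeff 0
  set F : OnePoint ℂ → ℂ := fun x => x.elim (G 0) fun z => G (1 / z) with hF
  have hFz : ∀ z : ℂ, 1 < ‖z‖ → F (z : OnePoint ℂ) = G (1 / z) := fun z _ => rfl
  refine ⟨F, ⟨G, hG, hFz, rfl⟩, ⟨?_, ?_, ?_⟩, hG0'⟩
  · exact (hf.1.1.analyticOnNhd isOpen_ball).meromorphicOn.fun_div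
      (hu.1.analyticOnNhd isOpen_ball).meromorphicOn
  · have hFG : (fun w : ℂ => F (invSphere w)) = G := by
      funext w
      by_cases hw : w = 0
      · simp only [invSphere, hw]; rfl
      · simp only [invSphere, if_neg hw]
        change G (1 / w⁻¹) = G w
        rw [one_div, inv_inv]
    rw [MeromorphicOnExt, hFG]
    exact (hG.1.analyticOnNhd isOpen_ball).meromorphicOn
  · rw [ae_circleMeasure_iff]
    filter_upwards [hφlim, hυlim, measurePreserving_neg_haarAddCircle.quasiMeasurePreserving.ae hGlim]
      with t h1 h2 h3
    have hne : υ t ≠ 0 := norm_pos_iff.1 (h2.2 ▸ one_pos)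
    refine ⟨q t, ?_, ?_⟩
    · rw [show q t = φ t / υ t from (div_eq_mul_conj h2.2).symm]
      exact h1.div h2.1 hne
    · rw [circlePt_neg, neg_neg] at h3
      exact h3.ext (norm_circlePt t) hFz

lemma mem_modelSpace_of_pseudocontinuation {u f : ℂ → ℂ} (hu : IsInner u) (hf : MemH2 f)
    {F : OnePoint ℂ → ℂ} (hF : MemH2Ext F) (hpc : IsPseudocontinuation (fun z => f z / u z) F)
    (hF0 : F OnePoint.infty = 0) : f ∈ modelSpace u := by
  obtain ⟨G, hG, hFz, hFinf⟩ := hF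
  obtain ⟨φ, hφ, -, -, hφlim⟩ := hf.exists_boundary
  obtain ⟨υ, hυ, hυlim⟩ := hu.exists_boundary
  obtain ⟨γ, hγ, hγ0, hγneg, hγlim⟩ := hG.exists_boundary
  refine ⟨hf, fun h hh => ?_⟩
  obtain ⟨η, hη, -, hηneg, hηlim⟩ := hh.exists_boundary
  rw [innerH2_eq_integral hφlim hυlim hηlim]
  -- Nontangential limits restrict to radial ones, whose uniqueness identifies `q` with the
  -- reflected boundary function of `G`.
  have heq : (fun t => φ t * conj (υ t)) =ᵐ[haarAddCircle] fun t => γ (-t) := by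
    filter_upwards [hφlim, hυlim, ae_circleMeasure_iff.1 hpc.2.2,
      measurePreserving_neg_haarAddCircle.quasiMeasurePreserving.ae hγlim]
      with t h1 h2 ⟨L, h3, h4⟩ h5
    have hne : υ t ≠ 0 := norm_pos_iff.1 (h2.2 ▸ one_pos)
    have e1 := tendsto_nhds_unique ((h1.div h2.1 hne).tendsto_radial (norm_circlePt t))
      (h3.tendsto_radial (norm_circlePt t))
    have e2 := tendsto_nhds_unique (h5.tendsto_radial (norm_circlePt _))
      (by rw [circlePt_neg]; exact h4.tendsto_radial (norm_circlePt t) hFz)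
    rw [← div_eq_mul_conj h2.2, e1, e2]
  refine integral_mul_conj_eq_zero (memLp_mul_conj hφ hυ) hη fun n => ?_
  rcases lt_or_ge n 0 with hn | hn
  · exact Or.inr (hηneg n hn)
  · left
    rw [fourierCoeff_congr_ae heq, fourierCoeff_comp_neg]
    -- Index `0` is the only one not covered by `G ∈ H²`; it needs `F ∞ = 0`.
    rcases hn.eq_or_lt with rfl | hn
    · rw [neg_zero, hγ0, ← hFinf, hF0]
    · exact hγneg _ (by omega)

end ModelSpace

theorem mainTheorem2 (u : ℂ → ℂ) (hu : ModelSpace.IsInner u) (f : ℂ → ℂ)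
    (hf : ModelSpace.MemH2 f) :
    f ∈ ModelSpace.modelSpace u ↔
      ∃ F : OnePoint ℂ → ℂ, ModelSpace.MemH2Ext F ∧
        ModelSpace.IsPseudocontinuation (fun z => f z / u z) F ∧
        F OnePoint.infty = 0 :=
  ⟨fun h => ModelSpace.exists_pseudocontinuation hu h, fun ⟨_, hF, hpc, hF0⟩ =>
    ModelSpace.mem_modelSpace_of_pseudocontinuation hu hf hF hpc hF0⟩
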